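/- **Definitions.** Let $V$ be a finite-dimensional complex vector space with a nondegenerate symmetric bilinear form $(\cdot,\cdot)$, and let $\mathfrak h\subset\mathfrak{so}(V)$ be a Lie subalgebra. Let $e_1,\dots,e_n$ be an orthonormal basis of $V$. Put $$\mathcal P(\mathfrak h)=\{P\in \mathrm{Hom}(V,\mathfrak h)\ :\ (P(u)v,w)+(P(v)w,u)+(P(w)u,v)=0\ \text{ for all } u,v,w\in V\},$$ let $\widetilde{\mathrm{Ric}}:\mathcal P(\mathfrak h)\to V$ be the map $\widetilde{\mathrm{Ric}}(P)=\sum_{i=1}^n P(e_i)e_i$ (which does not depend on the choice of the orthonormal basis), let $\mathcal P_0(\mathfrak h)=\ker\widetilde{\mathrm{Ric}}$, and let $\mathcal P_1(\mathfrak h)=\{Q\in\mathcal P(\mathfrak h): (P,Q)=0\ \text{for all } P\in\mathcal P_0(\mathfrak h)\}$ be its orthogonal complement in $\mathcal P(\mathfrak h)$ with respect to the induced form $(P,Q)=\sum_{i,j=1}^n(P(e_i)e_j,Q(e_i)e_j)$ on $\mathrm{Hom}(V,\mathfrak h)$. These are $\mathfrak h$-submodules of $\mathrm{Hom}(V,\mathfrak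 h)$. **Lemma (adjoint representation).** Let $\mathfrak h$ be a finite-dimensional simple complex Lie algebra that is not isomorphic to $\mathfrak{sl}(2,\mathbb C)$. Consider the adjoint representation $\mathfrak h\subset\mathfrak{so}(\mathfrak h)$, that is, $V=\mathfrak h$ with the Killing form as $(\cdot,\cdot)$ and $\mathfrak h$ acting on $V$ by $A\cdot v=[A,v]$. Then $\mathcal P(\mathfrak h)=\mathcal P_1(\mathfrak h)$, and $\mathcal P_1(\mathfrak h)\simeq\mathfrak h$ as $\mathfrak h$-modules. Moreover, for every $P\in\mathcal P(\mathfrak h)$ there is a fixed $x\in\mathfrak h$ such that $P(y)=[y,x]$ for all $y\in\mathfrak h$. -/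

import Mathlib

/-!
Weak curvature endomorphisms of an orthogonal representation.

`OrthogonalRep K 𝔥 V` expresses that the Lie algebra `𝔥` is a subalgebra of `𝔰𝔬(V)`: it records a
nondegenerate symmetric bilinear form on `V` such that `𝔥` acts faithfully on `V` by skew-symmetric
endomorphisms.  An element `A` of `𝔥`, seen as an endomorphism of `V`, is `v ↦ ⁅A, v⁆`.
-/

open LinearMap (BilinForm)

/-- The data of an inclusion `𝔥 ⊂ 𝔰𝔬(V)`: an inner product (a nondegenerate symmetric bilinear form)
on `V` for which the `𝔥`-module `V` is orthogonal, the action of `𝔥` on `V` being faithful. -/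
structure OrthogonalRep (K 𝔥 V : Type*) [Field K] [LieRing 𝔥] [LieAlgebra K 𝔥]
    [AddCommGroup V] [Module K V] [LieRingModule 𝔥 V] [LieModule K 𝔥 V] where
  /-- the inner product `( , )` on `V` -/
  form : BilinForm K V
  isSymm : form.IsSymm
  nondegenerate : form.Nondegenerate
  invariant : form.lieInvariant 𝔥
  faithful : LieModule.IsFaithful K 𝔥 V

namespace OrthogonalRep

variable {K 𝔥 V W : Type*} [Field K] [LieRing 𝔥] [LieAlgebra K 𝔥]
  [AddCommGroup V] [Module K V] [LieRingModule 𝔥 V] [LieModule K 𝔥 V]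
  [AddCommGroup W] [Module K W]

/-- Elements of `𝔥` act as elements of `𝔰𝔬(V)`. -/
theorem toEnd_mem_so (ρ : OrthogonalRep K 𝔥 V) (A : 𝔥) :
    LieModule.toEnd K 𝔥 V A ∈ skewAdjointLieSubalgebra ρ.form := by
  change LieModule.toEnd K 𝔥 V A ∈ ρ.form.skewAdjointSubmodule
  rw [LinearMap.mem_skewAdjointSubmodule]
  intro v w
  simpa using ρ.invariant A v w

section

attribute [local instance 100] LieRing.ofAssociativeRing

/-- The inclusion `𝔥 → 𝔰𝔬(V)` as a homomorphism of Lie algebras. -/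
def toSO (ρ : OrthogonalRep K 𝔥 V) : 𝔥 →ₗ⁅K⁆ skewAdjointLieSubalgebra ρ.form where
  toFun A := ⟨LieModule.toEnd K 𝔥 V A, ρ.toEnd_mem_so A⟩
  map_add' A A' := by ext; simp
  map_smul' c A := by ext; simp
  map_lie' {A A'} := Subtype.ext ((LieModule.toEnd K 𝔥 V).map_lie A A')

theorem toSO_injective (ρ : OrthogonalRep K 𝔥 V) : Function.Injective ρ.toSO := fun _ _ h =>
  ρ.faithful.injective_toEnd (congrArg Subtype.val h)

end

/-- `𝓟(𝔥)`: the linear maps `P : V → 𝔥` with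
`(P(u)v, w) + (P(v)w, u) + (P(w)u, v) = 0` for all `u, v, w ∈ V`,
as an `𝔥`-submodule of `Hom(V, 𝔥)`. -/
def curvP (ρ : OrthogonalRep K 𝔥 V) : LieSubmodule K 𝔥 (V →ₗ[K] 𝔥) where
  carrier := {P | ∀ u v w : V,
    ρ.form ⁅P u, v⁆ w + ρ.form ⁅P v, w⁆ u + ρ.form ⁅P w, u⁆ v = 0}
  add_mem' {P Q} hP hQ u v w := by
    have h := congrArg₂ (· + ·) (hP u v w) (hQ u v w)
    simp only [LinearMap.add_apply, add_lie, map_add, add_zero] at h ⊢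
    rw [← h]; abel
  zero_mem' u v w := by simp
  smul_mem' c P hP u v w := by
    have h := congrArg (c * ·) (hP u v w)
    simp only [LinearMap.smul_apply, smul_lie, map_smul, smul_eq_mul, mul_zero] at h ⊢
    rw [← h]; ring
  lie_mem {A P} hP u v w := by
    have h1 := hP ⁅A, u⁆ v w
    have h2 := hP u ⁅A, v⁆ w
    have h3 := hP u v ⁅A, w⁆
    have key : ∀ x y z : V, ρ.form ⁅⁅A, P x⁆, y⁆ z
        = - ρ.form ⁅P x, y⁆ ⁅A, z⁆ - ρ.form ⁅P x, ⁅A, y⁆⁆ z := by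
      intro x y z
      rw [lie_lie, map_sub, LinearMap.sub_apply, ρ.invariant]
    simp only [LieHom.lie_apply, sub_lie, map_sub, LinearMap.sub_apply, key]
    linear_combination -h1 - h2 - h3

theorem mem_curvP (ρ : OrthogonalRep K 𝔥 V) (P : V →ₗ[K] 𝔥) :
    P ∈ ρ.curvP ↔ ∀ u v w : V,
      ρ.form ⁅P u, v⁆ w + ρ.form ⁅P v, w⁆ u + ρ.form ⁅P w, u⁆ v = 0 := Iff.rfl

theorem sum_form_dualBasis_smul (ρ : OrthogonalRep K 𝔥 V) {ι : Type*} [Fintype ι] [DecidableEq ι]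
    (b : Module.Basis ι K V) (x : V) :
    ∑ i, ρ.form (ρ.form.dualBasis ρ.nondegenerate b i) x • b i = x := by
  have h := (ρ.form.dualBasis ρ.nondegenerate (ρ.form.dualBasis ρ.nondegenerate b)).sum_repr x
  simp only [LinearMap.BilinForm.dualBasis_repr_apply] at h
  rw [LinearMap.BilinForm.dualBasis_dualBasis _ ρ.isSymm] at h
  simpa only [ρ.isSymm.eq x] using h

theorem sum_form_smul_dualBasis (ρ : OrthogonalRep K 𝔥 V) {ι : Type*} [Fintype ι] [DecidableEq ι]
    (b : Module.Basis ι K V) (x : V) :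
    ∑ i, ρ.form x (b i) • ρ.form.dualBasis ρ.nondegenerate b i = x := by
  have h := (ρ.form.dualBasis ρ.nondegenerate b).sum_repr x
  simpa only [LinearMap.BilinForm.dualBasis_repr_apply] using h

section FiniteDimensional

variable [FiniteDimensional K V]

/-- The contraction `∑ᵢ β(eᵢ, eⁱ)` of a bilinear map `β` on `V` by means of the inner product, where
`(eᵢ)` is a basis of `V` and `(eⁱ)` the dual basis: `(eⁱ, eⱼ) = δᵢⱼ`.  It does not depend on the
basis (`contract_eq`); for an orthonormal basis it is `∑ᵢ β(eᵢ, eᵢ)` (`contract_eq_orthonormal`). -/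
noncomputable def contract (ρ : OrthogonalRep K 𝔥 V) (β : V →ₗ[K] V →ₗ[K] W) : W :=
  ∑ i, β (Module.finBasis K V i) (ρ.form.dualBasis ρ.nondegenerate (Module.finBasis K V) i)

theorem contract_eq (ρ : OrthogonalRep K 𝔥 V) (β : V →ₗ[K] V →ₗ[K] W)
    {ι : Type*} [Fintype ι] [DecidableEq ι] (b : Module.Basis ι K V) :
    ρ.contract β = ∑ i, β (b i) (ρ.form.dualBasis ρ.nondegenerate b i) := by
  set c := Module.finBasis K V with hc
  calc ρ.contract β
      = ∑ i, β (c i) (ρ.form.dualBasis ρ.nondegenerate c i) := rfl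
    _ = ∑ i, β (c i) (∑ k, ρ.form (ρ.form.dualBasis ρ.nondegenerate c i) (b k) •
          ρ.form.dualBasis ρ.nondegenerate b k) := by
        simp only [sum_form_smul_dualBasis]
    _ = ∑ k, β (∑ i, ρ.form (ρ.form.dualBasis ρ.nondegenerate c i) (b k) • c i)
          (ρ.form.dualBasis ρ.nondegenerate b k) := by
        simp only [map_sum, map_smul, LinearMap.sum_apply, LinearMap.smul_apply]
        exact Finset.sum_comm
    _ = ∑ k, β (b k) (ρ.form.dualBasis ρ.nondegenerate b k) := by
        simp only [sum_form_dualBasis_smul]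

theorem contract_eq_orthonormal (ρ : OrthogonalRep K 𝔥 V) (β : V →ₗ[K] V →ₗ[K] W)
    {ι : Type*} [Fintype ι] [DecidableEq ι] (e : Module.Basis ι K V)
    (he : ∀ i j, ρ.form (e i) (e j) = if i = j then 1 else 0) :
    ρ.contract β = ∑ i, β (e i) (e i) := by
  have h : (ρ.form.dualBasis ρ.nondegenerate e : ι → V) = e :=
    (LinearMap.BilinForm.dualBasis_eq_iff ρ.nondegenerate e e).2 fun i j => by
      rw [he]; simp only [eq_comm]
  rw [contract_eq ρ β e]
  simp only [h]

/-- The contraction is invariant under the action of `𝔥` on the arguments. -/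
theorem contract_invariant (ρ : OrthogonalRep K 𝔥 V) (β : V →ₗ[K] V →ₗ[K] W) (A : 𝔥) :
    ρ.contract (β.compl₁₂ (LieModule.toEnd K 𝔥 V A) LinearMap.id)
      = - ρ.contract (β.compl₁₂ LinearMap.id (LieModule.toEnd K 𝔥 V A)) := by
  rw [eq_neg_iff_add_eq_zero, add_comm, ← eq_neg_iff_add_eq_zero]
  set b := Module.finBasis K V
  set d := ρ.form.dualBasis ρ.nondegenerate b
  calc ρ.contract (β.compl₁₂ LinearMap.id (LieModule.toEnd K 𝔥 V A))
      = ∑ i, β (b i) ⁅A, d i⁆ := rfl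
    _ = ∑ i, β (b i) (∑ k, ρ.form ⁅A, d i⁆ (b k) • d k) := by
        simp only [d, sum_form_smul_dualBasis]
    _ = - ∑ k, β (∑ i, ρ.form (d i) ⁅A, b k⁆ • b i) (d k) := by
        simp only [ρ.invariant A, map_sum, map_smul, LinearMap.sum_apply, LinearMap.smul_apply,
          neg_smul, Finset.sum_neg_distrib, map_neg]
        rw [Finset.sum_comm]
    _ = - ∑ k, β ⁅A, b k⁆ (d k) := by
        simp only [d, sum_form_dualBasis_smul]
    _ = - ρ.contract (β.compl₁₂ (LieModule.toEnd K 𝔥 V A) LinearMap.id) := rfl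

/-- The `𝔥`-equivariant map `Hom(V, 𝔥) → V`, `P ↦ ∑ᵢ P(eᵢ)eᵢ` (`eᵢ` an orthonormal basis), whose
restriction to `𝓟(𝔥)` is `R̃ic`. -/
noncomputable def ricTilde (ρ : OrthogonalRep K 𝔥 V) : (V →ₗ[K] 𝔥) →ₗ⁅K,𝔥⁆ V where
  toFun P := ρ.contract ((LieModule.toEnd K 𝔥 V : 𝔥 →ₗ[K] Module.End K V) ∘ₗ P)
  map_add' P Q := by simp [contract, Finset.sum_add_distrib]
  map_smul' c P := by simp [contract, Finset.smul_sum]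
  map_lie' {A P} := by
    have h := ρ.contract_invariant
      ((LieModule.toEnd K 𝔥 V : 𝔥 →ₗ[K] Module.End K V) ∘ₗ P) A
    simp only [contract, LinearMap.compl₁₂_apply, LinearMap.comp_apply, LinearMap.id_apply,
      LieHom.coe_toLinearMap, LieModule.toEnd_apply_apply, LieHom.lie_apply, map_sub,
      LinearMap.sub_apply, lie_lie, Finset.sum_sub_distrib, lie_sum] at h ⊢
    rw [h]
    abel

theorem ricTilde_apply (ρ : OrthogonalRep K 𝔥 V) (P : V →ₗ[K] 𝔥)
    {ι : Type*} [Fintype ι] [DecidableEq ι] (e : Module.Basis ι K V)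
    (he : ∀ i j, ρ.form (e i) (e j) = if i = j then 1 else 0) :
    ρ.ricTilde P = ∑ i, ⁅P (e i), e i⁆ :=
  ρ.contract_eq_orthonormal _ e he

/-- The inner product on `Hom(V, 𝔥) = V* ⊗ 𝔥` induced by the one on `V`:
`(P, Q) = ∑ᵢ (P(eᵢ), Q(eᵢ))` for an orthonormal basis `eᵢ`, where `𝔥 ⊂ 𝔰𝔬(V)` carries the inner
product `(A, A') = ∑ⱼ (A eⱼ, A' eⱼ) = tr (Aᵀ A') = - tr (A A')`. -/
noncomputable def homInner (ρ : OrthogonalRep K 𝔥 V) (P Q : V →ₗ[K] 𝔥) : K :=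
  ρ.contract ((-(LieModule.traceForm K 𝔥 V)).compl₁₂ P Q)

theorem trace_eq_contract (ρ : OrthogonalRep K 𝔥 V) (A A' : 𝔥) :
    -(LieModule.traceForm K 𝔥 V A A') = ρ.contract
      (ρ.form.compl₁₂ (LieModule.toEnd K 𝔥 V A) (LieModule.toEnd K 𝔥 V A')) := by
  set d := ρ.form.dualBasis ρ.nondegenerate (Module.finBasis K V) with hd
  rw [LieModule.traceForm_apply_apply,
    LinearMap.trace_eq_matrix_trace K d]
  simp only [Matrix.trace, Matrix.diag, LinearMap.toMatrix_apply, contract,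
    LinearMap.compl₁₂_apply, LieModule.toEnd_apply_apply, LinearMap.comp_apply]
  rw [← Finset.sum_neg_distrib]
  refine Finset.sum_congr rfl fun i _ => ?_
  rw [hd, LinearMap.BilinForm.dualBasis_repr_apply, ρ.invariant A, neg_neg, ← hd, ρ.isSymm.eq]

theorem homInner_apply (ρ : OrthogonalRep K 𝔥 V) (P Q : V →ₗ[K] 𝔥)
    {ι : Type*} [Fintype ι] [DecidableEq ι] (e : Module.Basis ι K V)
    (he : ∀ i j, ρ.form (e i) (e j) = if i = j then 1 else 0) :
    ρ.homInner P Q = ∑ i, ∑ j, ρ.form ⁅P (e i), e j⁆ ⁅Q (e i), e j⁆ := by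
  rw [homInner, ρ.contract_eq_orthonormal _ e he]
  refine Finset.sum_congr rfl fun i _ => ?_
  rw [LinearMap.compl₁₂_apply, LinearMap.neg_apply, LinearMap.neg_apply, trace_eq_contract ρ,
    ρ.contract_eq_orthonormal _ e he]
  rfl

theorem homInner_lie (ρ : OrthogonalRep K 𝔥 V) (A : 𝔥) (P Q : V →ₗ[K] 𝔥) :
    ρ.homInner P ⁅A, Q⁆ = - ρ.homInner ⁅A, P⁆ Q := by
  have h := ρ.contract_invariant ((-(LieModule.traceForm K 𝔥 V)).compl₁₂ P Q) A
  have t : ∀ x y : 𝔥, LieModule.traceForm K 𝔥 V x ⁅A, y⁆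
      = - LieModule.traceForm K 𝔥 V ⁅A, x⁆ y := by
    intro x y
    rw [LieModule.traceForm_apply_lie_apply', neg_neg]
  simp only [homInner, contract, LinearMap.compl₁₂_apply, LinearMap.id_apply,
    LieModule.toEnd_apply_apply, LieHom.lie_apply, map_sub,
    LinearMap.sub_apply, LinearMap.neg_apply, Finset.sum_sub_distrib, t,
    Finset.sum_neg_distrib] at h ⊢
  linear_combination -h

/-- `𝓟₀(𝔥)`: the kernel of `R̃ic : 𝓟(𝔥) → V`. -/
noncomputable def curvP₀ (ρ : OrthogonalRep K 𝔥 V) : LieSubmodule K 𝔥 (V →ₗ[K] 𝔥) :=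
  ρ.curvP ⊓ ρ.ricTilde.ker

/-- `𝓟₁(𝔥)`: the orthogonal complement of `𝓟₀(𝔥)` in `𝓟(𝔥)`. -/
noncomputable def curvP₁ (ρ : OrthogonalRep K 𝔥 V) : LieSubmodule K 𝔥 (V →ₗ[K] 𝔥) where
  carrier := {Q | Q ∈ ρ.curvP ∧ ∀ P ∈ ρ.curvP₀, ρ.homInner P Q = 0}
  add_mem' {Q Q'} hQ hQ' := ⟨add_mem hQ.1 hQ'.1, fun P hP => by
    have h := congrArg₂ (· + ·) (hQ.2 P hP) (hQ'.2 P hP)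
    simpa [homInner, contract, Finset.sum_add_distrib, add_comm] using h⟩
  zero_mem' := ⟨zero_mem _, fun P _ => by simp [homInner, contract]⟩
  smul_mem' c Q hQ := ⟨SMulMemClass.smul_mem c hQ.1, fun P hP => by
    have h := congrArg (c * ·) (hQ.2 P hP)
    simpa [homInner, contract, Finset.mul_sum] using h⟩
  lie_mem {A Q} hQ := ⟨LieSubmodule.lie_mem _ hQ.1, fun P hP => by
    rw [homInner_lie, hQ.2 _ (LieSubmodule.lie_mem _ hP), neg_zero]⟩

theorem mem_curvP₁ (ρ : OrthogonalRep K 𝔥 V) (Q : V →ₗ[K] 𝔥) :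
    Q ∈ ρ.curvP₁ ↔ Q ∈ ρ.curvP ∧ ∀ P ∈ ρ.curvP₀, ρ.homInner P Q = 0 := Iff.rfl

end FiniteDimensional

end OrthogonalRep

/-- The adjoint representation `𝔥 ⊂ 𝔰𝔬(𝔥)` of a Lie algebra with nondegenerate Killing form (in
particular, of a simple Lie algebra in characteristic zero), the inner product on `𝔥` being the
Killing form. -/
noncomputable def adjointRep (K 𝔥 : Type*) [Field K] [LieRing 𝔥] [LieAlgebra K 𝔥]
    [FiniteDimensional K 𝔥] [LieAlgebra.IsKilling K 𝔥] : OrthogonalRep K 𝔥 𝔥 where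
  form := killingForm K 𝔥
  isSymm := ⟨LieModule.traceForm_comm K 𝔥 𝔥⟩
  nondegenerate := LieAlgebra.IsKilling.killingForm_nondegenerate K 𝔥
  invariant := LieModule.traceForm_lieInvariant K 𝔥 𝔥
  faithful := (LieAlgebra.isFaithful_self_iff K 𝔥).2 (LieAlgebra.center_eq_bot K 𝔥)

/-!
Invariance turns the condition defining `𝓟(𝔥)` for the adjoint representation into the cyclic
identity `(P u, ⁅v, w⁆) + (P v, ⁅w, u⁆) + (P w, ⁅u, v⁆) = 0` for the Killing form. If `P` is
skew-symmetric, this says that `P` is a derivation, hence inner. So the point is that the symmetric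
form `S (x, y) = (P x, y) + (x, P y)` vanishes when the rank is not one; this is
`killingSymmPart_eq_zero`.

The cyclic identity implies that `S ⁅u, v⁆ ⁅w, x⁆` satisfies the algebraic Bianchi identity
(`satisfiesBianchi_killingSymmPart`). Evaluating that identity on elements of a Cartan subalgebra and
on root vectors shows that two root spaces can pair non-trivially under `S` only if they are
opposite. Here rank at least two enters: by irreducibility of the root system every root `α` has a
root neither proportional nor orthogonal to it (`exists_apply_coroot_ne_zero`), so that the roots not
proportional to `α` span, and `α` is a sum of two roots `β`, `γ` not proportional to it
(`exists_add_eq_root`). On opposite root spaces `S` is `s α` times the Killing form; the Bianchi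
identity gives `s α = s β = s γ`, and the cyclic identity for `P` itself gives
`s α + s β + s γ = 0`, so that `S` vanishes there too (`killingSymmPart_apply_neg_eq_zero`), and then
also on the Cartan subalgebra. A simple algebra of rank one is `𝔰𝔩₂`
(`nonempty_equiv_sl_two_of_finrank_eq_one`).

Finally, `R̃ic` maps `y ↦ ⁅y, x⁆` to `-x`, the Casimir element of the Killing form acting as the
identity. Hence `𝓟₀(𝔥) = 0`, so that `𝓟₁(𝔥) = 𝓟(𝔥)`, and `R̃ic` is an isomorphism from `𝓟(𝔥)`
onto `𝔥`.
-/

namespace LieAlgebra.IsKilling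

open LieModule Module

variable {K L : Type*} [Field K] [CharZero K] [LieRing L] [LieAlgebra K L]
  [IsKilling K L] [FiniteDimensional K L]
  {H : LieSubalgebra K L} [H.IsCartanSubalgebra] [IsTriangularizable K H L]

/-! ### Root spaces of a Killing Lie algebra -/

omit [IsKilling K L] [IsTriangularizable K H L] in
lemma weight_apply_smul_sub_smul (α : Weight K H L) (a b : K) (u v : H) :
    α (a • u - b • v) = a * α u - b * α v := by
  simp only [← Weight.toLinear_apply, map_sub, map_smul, smul_eq_mul]

omit [IsKilling K L] [IsTriangularizable K H L] in
lemma exists_apply_eq_zero_and_ne_zero {α β : Weight K H L}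
    (h : ∃ u v : H, α u * β v ≠ α v * β u) : ∃ t : H, β t = 0 ∧ α t ≠ 0 := by
  obtain ⟨u, v, h⟩ := h
  refine ⟨β v • u - β u • v, ?_, ?_⟩
  · rw [weight_apply_smul_sub_smul]; ring
  · rw [weight_apply_smul_sub_smul]
    contrapose! h
    linear_combination h

/-- Roots are proportional only if they are equal or opposite. -/
lemma exists_mul_ne_mul {α β : Weight K H L} (hα : α.IsNonZero) (hβ : β.IsNonZero)
    (h₁ : β ≠ α) (h₂ : β ≠ -α) : ∃ u v : H, α u * β v ≠ α v * β u := by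
  by_contra! h
  obtain ⟨v, hv⟩ : ∃ v, α v ≠ 0 := by
    by_contra! h0
    exact hα (funext h0)
  have : (β : H → K) = (β v / α v) • (α : H → K) := by
    funext u
    simp only [Pi.smul_apply, smul_eq_mul]
    field_simp
    linear_combination -h u v
  rcases eq_neg_or_eq_of_eq_smul α β hβ _ this with h | h
  · exact h₂ h
  · exact h₁ h

omit [CharZero K] in
lemma exists_killingForm_ne_zero {α : H → K} {x : L} (hx : x ∈ rootSpace H α) (h0 : x ≠ 0) :
    ∃ y ∈ rootSpace H (-α), killingForm K L x y ≠ 0 := by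
  contrapose! h0
  have := mem_ker_killingForm_of_mem_rootSpace_of_forall_rootSpace_neg K L H hx h0
  rwa [ker_killingForm_eq_bot, Submodule.mem_bot] at this

lemma exists_smul_eq_of_mem_rootSpace {α : Weight K H L} (hα : α.IsNonZero) {x y : L}
    (hx : x ∈ rootSpace H α) (h0 : x ≠ 0) (hy : y ∈ rootSpace H α) : ∃ c : K, y = c • x := by
  obtain ⟨c, hc⟩ := (finrank_eq_one_iff_of_nonzero' ⟨x, hx⟩
    (by rwa [ne_eq, LieSubmodule.mk_eq_zero])).mp (finrank_rootSpace_eq_one α hα) ⟨y, hy⟩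
  exact ⟨c, by simpa using hc.symm⟩

/-- The root spaces of opposite roots being one-dimensional, every bilinear form is a multiple of
the Killing form on their product. -/
lemma exists_apply_eq_mul_killingForm (F : BilinForm K L) {α : Weight K H L} (hα : α.IsNonZero) :
    ∃ c : K, ∀ x ∈ rootSpace H α, ∀ y ∈ rootSpace H (-α), F x y = c * killingForm K L x y := by
  obtain ⟨e, he, he0⟩ := α.exists_ne_zero
  obtain ⟨f, hf, hf0⟩ := exists_killingForm_ne_zero he he0
  refine ⟨F e f / killingForm K L e f, fun x hx y hy ↦ ?_⟩
  obtain ⟨a, rfl⟩ := exists_smul_eq_of_mem_rootSpace hα he he0 hx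
  have hf0' : f ≠ 0 := by rintro rfl; simp at hf0
  obtain ⟨b, rfl⟩ := exists_smul_eq_of_mem_rootSpace (α := -α) (by simpa) hf hf0' hy
  simp only [map_smul, LinearMap.smul_apply, smul_eq_mul]
  field_simp

omit [CharZero K] [IsKilling K L] in
lemma weightSpace_induction {p : L → Prop} (zero : p 0) (add : ∀ x y, p x → p y → p (x + y))
    (weight : ∀ α : Weight K H L, ∀ x ∈ rootSpace H α, p x) (x : L) : p x := by
  have hx : x ∈ ⨆ χ : Weight K H L, genWeightSpace L χ := by
    rw [iSup_genWeightSpace_eq_top']; trivial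
  exact LieSubmodule.iSup_induction (motive := p) _ hx weight zero add

omit [CharZero K] [IsKilling K L] in
lemma bilinForm_eq_zero_of_weightSpaces (F : BilinForm K L)
    (h : ∀ α β : Weight K H L, ∀ x ∈ rootSpace H α, ∀ y ∈ rootSpace H β, F x y = 0) : F = 0 := by
  ext x y
  refine weightSpace_induction (H := H) (p := fun x ↦ F x y = 0) (by simp)
    (fun a b ha hb ↦ by simp [ha, hb]) (fun α x hx ↦ ?_) x
  exact weightSpace_induction (H := H) (p := fun y ↦ F x y = 0) (by simp)
    (fun a b ha hb ↦ by simp [ha, hb]) (fun β y hy ↦ h α β x hx y hy) y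

/-! ### Rank one -/

/-- If the Cartan subalgebra is a line, then the algebra is isomorphic to `𝔰𝔩₂`. -/
lemma nonempty_equiv_sl_two_of_finrank_eq_one (h : finrank K H = 1) :
    Nonempty (L ≃ₗ⁅K⁆ SpecialLinear.sl (Fin 2) K) := by
  obtain ⟨α, hα⟩ : ∃ α : Weight K H L, α.IsNonZero := by
    by_contra! h0
    have hs := span_weight_isNonZero_eq_top K L H
    have hemp : {α : Weight K H L | α.IsNonZero} = ∅ := by
      ext α; simpa using h0 α
    rw [hemp, Set.image_empty, Submodule.span_empty] at hs
    have : finrank K (Dual K H) = 0 := by rw [← finrank_top, ← hs, finrank_bot]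
    rw [Subspace.dual_finrank_eq] at this
    omega
  obtain ⟨t, e, f, ht, he, hf⟩ := exists_isSl2Triple_of_weight_isNonZero hα
  have htc := ht.h_eq_coroot hα he hf
  let φ : SpecialLinear.sl (Fin 2) K →ₗ⁅K⁆ L :=
    { toFun A := A.1 0 0 • t + A.1 0 1 • e + A.1 1 0 • f
      map_add' A A' := by
        have h (i j) : (A + A').1 i j = A.1 i j + A'.1 i j := rfl
        simp only [h]
        module
      map_smul' c A := by
        have h (i j) : (c • A).1 i j = c * A.1 i j := rfl
        simp only [h, RingHom.id_apply]
        module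
      map_lie' := by
        intro A A'
        have hA : A.1 1 1 = - A.1 0 0 := by
          have : A.1.trace = 0 := A.2
          rw [Matrix.trace_fin_two] at this
          linear_combination this
        have hA' : A'.1 1 1 = - A'.1 0 0 := by
          have : A'.1.trace = 0 := A'.2
          rw [Matrix.trace_fin_two] at this
          linear_combination this
        have h1 : ⁅e, t⁆ = -((2 : K) • e) := by rw [← lie_skew, ht.lie_h_e_smul K]
        have h2 : ⁅f, t⁆ = (2 : K) • f := by rw [← lie_skew, ht.lie_lie_smul_f K, neg_neg]
        have h3 : ⁅f, e⁆ = -t := by rw [← lie_skew, ht.lie_e_f]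
        simp only [SpecialLinear.sl_bracket, Matrix.sub_apply, Matrix.mul_apply, Fin.sum_univ_two,
          hA, hA', add_lie, lie_add, smul_lie, lie_smul, lie_self, ht.lie_h_e_smul K,
          ht.lie_lie_smul_f K, h1, h2, h3, ht.lie_e_f]
        module }
  have hinj : Function.Injective φ := by
    rw [injective_iff_map_eq_zero]
    intro A hA
    replace hA : A.1 0 0 • t + A.1 0 1 • e + A.1 1 0 • f = 0 := hA
    have h1 := congrArg (⁅t, ·⁆) hA
    simp only [lie_add, lie_smul, lie_self, ht.lie_h_e_smul K, ht.lie_lie_smul_f K, lie_zero] at h1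
    have h2 := congrArg (⁅t, ·⁆) h1
    simp only [lie_add, lie_smul, lie_neg, lie_zero, ht.lie_h_e_smul K,
      ht.lie_lie_smul_f K] at h2
    have he' : (8 * A.1 0 1) • e = 0 := by 
      linear_combination (norm := module) (2 : K) • h1 + h2
    have hf' : (8 * A.1 1 0) • f = 0 := by 
      linear_combination (norm := module) h2 - (2 : K) • h1
    have a01 : A.1 0 1 = 0 := by simpa [ht.e_ne_zero] using he'
    have a10 : A.1 1 0 = 0 := by simpa [ht.f_ne_zero] using hf'
    have a00 : A.1 0 0 = 0 := by simpa [a01, a10, ht.h_ne_zero] using hA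
    have a11 : A.1 1 1 = 0 := by
      have : A.1.trace = 0 := A.2
      simpa [Matrix.trace_fin_two, a00] using this
    ext i j
    fin_cases i <;> fin_cases j <;> simp [a00, a01, a10, a11]
  have hH (x : H) : ∃ c : K, x = c • coroot α := by
    obtain ⟨c, hc⟩ := (finrank_eq_one_iff_of_nonzero' (coroot α) (by simpa)).mp h x
    exact ⟨c, hc.symm⟩
  have hsurj : Function.Surjective φ := by
    intro x
    refine weightSpace_induction (H := H) (p := fun x ↦ ∃ A, φ A = x) ⟨0, map_zero φ⟩
      (fun _ _ ⟨a, ha⟩ ⟨b, hb⟩ ↦ ⟨a + b, by rw [map_add, ha, hb]⟩) (fun β y hy ↦ ?_) x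
    have hφ (a b c : K) : ∃ A, φ A = a • t + b • e + c • f :=
      ⟨⟨!![a, b; c, -a], by
        change Matrix.trace !![a, b; c, -a] = 0
        simp [Matrix.trace_fin_two]⟩, by simp [φ]⟩
    by_cases hβ : β.IsZero
    · have hyH : y ∈ H := by
        rw [hβ.eq] at hy
        simpa [rootSpace_zero_eq] using hy
      obtain ⟨c, hc⟩ := hH ⟨y, hyH⟩
      obtain ⟨A, hA⟩ := hφ c 0 0
      refine ⟨A, ?_⟩
      rw [hA, htc]
      simpa using (congrArg Subtype.val hc).symm
    have hprop : (β : H → K) = (β (coroot α) / 2) • (α : H → K) := by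
      funext x
      obtain ⟨c, rfl⟩ := hH x
      simp only [Pi.smul_apply, smul_eq_mul, ← Weight.toLinear_apply, map_smul]
      rw [Weight.toLinear_apply, Weight.toLinear_apply, root_apply_coroot hα]
      ring
    rcases eq_neg_or_eq_of_eq_smul α β hβ _ hprop with rfl | rfl
    · obtain ⟨c, rfl⟩ := exists_smul_eq_of_mem_rootSpace hβ hf ht.f_ne_zero hy
      simpa using hφ 0 0 c
    · obtain ⟨c, rfl⟩ := exists_smul_eq_of_mem_rootSpace hβ he ht.e_ne_zero hy
      simpa using hφ 0 c 0
  exact ⟨(LieEquiv.ofBijective φ ⟨hinj, hsurj⟩).symm⟩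

/-! ### Roots in rank at least two -/

/-- In a simple Lie algebra of rank different from one, every root has a root which is neither
proportional nor orthogonal to it: otherwise the line it spans would be invariant under the Weyl
group, against the irreducibility of the root system. -/
lemma exists_apply_coroot_ne_zero [IsSimple K L] (hrank : finrank K H ≠ 1)
    {α : Weight K H L} (hα : α.IsNonZero) :
    ∃ β : Weight K H L, β.IsNonZero ∧ β ≠ α ∧ β ≠ -α ∧ β (coroot α) ≠ 0 := by
  by_contra! h
  refine hrank ?_
  rw [← Subspace.dual_finrank_eq, ← finrank_top]
  have hα0 : Weight.toLinear K H L α ≠ 0 := by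
    rwa [ne_eq, Weight.coe_toLinear_eq_zero_iff]
  rw [← RootPairing.IsIrreducible.eq_top_of_invtSubmodule_reflection (P := rootSystem H)
    (K ∙ Weight.toLinear K H L α) (fun β ↦ ?_) (by simpa using hα0),
    finrank_span_singleton hα0]
  rw [Module.End.mem_invtSubmodule, Submodule.span_singleton_le_iff_mem, Submodule.mem_comap]
  have hβ := H.isNonZero_coe_root β
  have hr : (rootSystem H).reflection β (Weight.toLinear K H L α) = Weight.toLinear K H L α -
      α (coroot β.1) • Weight.toLinear K H L β.1 := by
    rw [RootPairing.reflection_apply]; rfl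
  rw [LinearEquiv.coe_coe, hr]
  refine sub_mem (Submodule.mem_span_singleton_self _) ?_
  by_cases h1 : β.1 = α
  · rw [h1]
    exact Submodule.smul_mem _ _ (Submodule.mem_span_singleton_self _)
  by_cases h2 : β.1 = -α
  · rw [h2, Weight.toLinear_neg]
    exact Submodule.smul_mem _ _ (neg_mem (Submodule.mem_span_singleton_self _))
  have h3 : (rootSystem H).pairing β ⟨α, by simpa using hα⟩ = 0 := h β.1 hβ h1 h2
  rw [RootPairing.pairing_eq_zero_iff] at h3
  have h4 : α (coroot β.1) = 0 := h3
  simp [h4]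

/-- The roots not proportional to a given root `α` still span the dual of the Cartan subalgebra,
since `α` is a combination of a root `β` not orthogonal to it and the reflection of `β`. -/
lemma dual_linearMap_eq_zero [IsSimple K L] (hrank : finrank K H ≠ 1) {α : Weight K H L}
    (hα : α.IsNonZero) (ψ : Dual K H →ₗ[K] K)
    (hψ : ∀ γ : Weight K H L, γ.IsNonZero → γ ≠ α → γ ≠ -α → ψ (Weight.toLinear K H L γ) = 0) :
    ψ = 0 := by
  obtain ⟨β, hβ, h₁, h₂, h⟩ := exists_apply_coroot_ne_zero hrank hα
  have hαψ : ψ (Weight.toLinear K H L α) = 0 := by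
    have hγ : Weight.toLinear K H L (reflectRoot α β) =
        Weight.toLinear K H L β - β (coroot α) • Weight.toLinear K H L α := by
      ext; rfl
    obtain ⟨u, v, huv⟩ := exists_mul_ne_mul hα hβ h₁ h₂
    have e (x : H) : (reflectRoot α β) x = β x - β (coroot α) * α x := rfl
    have := hψ (reflectRoot α β) (reflectRoot_isNonZero α β hβ)
      (fun h' ↦ huv ?_) (fun h' ↦ huv ?_)
    · rw [hγ, map_sub, hψ β hβ h₁ h₂, map_smul, zero_sub, neg_eq_zero, smul_eq_mul] at this
      exact (mul_eq_zero.mp this).resolve_left h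
    · rw [h'] at e
      linear_combination α v * e u - α u * e v
    · rw [h'] at e
      simp only [Weight.coe_neg, Pi.neg_apply] at e
      linear_combination α v * e u - α u * e v
  refine LinearMap.ext_on (span_weight_isNonZero_eq_top K L H) ?_
  rintro _ ⟨γ, hγ, rfl⟩
  by_cases h1 : γ = α
  · rw [h1, hαψ]; rfl
  by_cases h2 : γ = -α
  · rw [h2, Weight.toLinear_neg, map_neg, hαψ, neg_zero]; rfl
  exact hψ γ hγ h1 h2

/-- Every root `α` is a sum of two roots `β` and `γ`, with `β` not proportional to `α`, such that
the brackets of the root spaces of `β` and `γ` and of those of `-β` and `-γ` do not vanish. One can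
take for `β` the top of an `α`-chain. -/
lemma exists_add_eq_root [IsSimple K L] (hrank : finrank K H ≠ 1) {α : Weight K H L}
    (hα : α.IsNonZero) :
    ∃ β γ : Weight K H L, (β : H → K) + γ = α ∧ β.IsNonZero ∧ γ.IsNonZero ∧
      (∃ s t : H, α s * β t ≠ α t * β s) ∧
      (∃ u ∈ rootSpace H β, ∃ v ∈ rootSpace H γ, ⁅u, v⁆ ≠ 0) ∧
      (∃ u ∈ rootSpace H (-β), ∃ v ∈ rootSpace H (-γ), ⁅u, v⁆ ≠ 0) := by
  obtain ⟨δ, hδ, h₁, h₂, h⟩ := exists_apply_coroot_ne_zero hrank hα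
  set β := chainTop α δ with hβdef
  have hβδ : (β : H → K) = chainTopCoeff α δ • (α : H → K) + δ := by
    rw [hβdef, coe_chainTop, natCast_zsmul]
  obtain ⟨s, t, hst⟩ : ∃ s t : H, α s * β t ≠ α t * β s := by
    obtain ⟨s, t, hst⟩ := exists_mul_ne_mul hα hδ h₁ h₂
    refine ⟨s, t, fun h' ↦ hst ?_⟩
    simp only [hβδ, Pi.add_apply, Pi.smul_apply] at h'
    simp only [nsmul_eq_mul] at h'
    linear_combination h'
  obtain ⟨x, hx, hx0⟩ := β.exists_ne_zero
  obtain ⟨c, e, f, ht, he, hf⟩ := exists_isSl2Triple_of_weight_isNonZero hα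
  have hβα : rootSpace H ((α : H → K) + β) = ⊥ := by
    have := genWeightSpace_chainTopCoeff_add_one_nsmul_add (M := L) (α : H → K) δ hα
    rwa [hβδ, ← add_assoc, add_comm (α : H → K), ← succ_nsmul]
  have hβc : β (coroot α) ≠ 0 := by
    intro h0
    have h3 := chainLength_smul α δ hx
    have h4 : ⁅coroot α, x⁆ = β (coroot α) • x := lie_eq_smul_of_mem_rootSpace hx _
    rw [h4, h0, zero_smul, smul_eq_zero_iff_left hx0, Nat.cast_eq_zero,
      ← chainTopCoeff_add_chainBotCoeff] at h3
    rw [apply_coroot_eq_cast] at h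
    refine h ?_
    rw [show chainBotCoeff α δ = 0 by omega, show chainTopCoeff α δ = 0 by omega]
    simp
  have hβ0 : β.IsNonZero := fun h0 ↦ hβc (by rw [h0.eq]; rfl)
  have hex : ⁅e, x⁆ = 0 := by
    have : ⁅e, x⁆ ∈ rootSpace H ((α : H → K) + β) :=
      lie_mem_genWeightSpace_of_mem_genWeightSpace he hx
    rwa [hβα, LieSubmodule.mem_bot] at this
  -- `x` is a highest weight vector of non-zero weight for the `𝔰𝔩₂` of `α`.
  have hfx : ⁅f, x⁆ ≠ 0 := by
    intro h0
    have h3 : ⁅c, x⁆ = β (coroot α) • x := by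
      rw [ht.h_eq_coroot hα he hf]
      exact lie_eq_smul_of_mem_rootSpace hx _
    rw [← ht.lie_e_f, lie_lie, h0, hex, lie_zero, lie_zero, sub_zero, eq_comm,
      smul_eq_zero] at h3
    exact h3.elim hβc hx0
  have hfxm : ⁅f, x⁆ ∈ rootSpace H (-(α : H → K) + β) :=
    lie_mem_genWeightSpace_of_mem_genWeightSpace hf hx
  obtain ⟨v, hv, hfv⟩ := exists_killingForm_ne_zero hfxm hfx
  have hv0 : v ≠ 0 := by rintro rfl; simp at hfv
  let γ : Weight K H L := ⟨-(-(α : H → K) + β), fun h0 ↦ hv0 ((LieSubmodule.mem_bot v).mp (h0.le hv))⟩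
  have hγ : (γ : H → K) = -(-(α : H → K) + β) := rfl
  refine ⟨β, γ, by rw [hγ]; abel, hβ0, fun h0 ↦ hst ?_, ⟨s, t, hst⟩,
    ⟨x, hx, v, hv, fun h0 ↦ hfv ?_⟩, ?_⟩
  · have e1 (r : H) : -(-α r + β r) = 0 := congrFun h0 r
    linear_combination α t * e1 s - α s * e1 t
  · rw [LieModule.traceForm_apply_lie_apply, h0, map_zero]
  · obtain ⟨y, hy, hxy⟩ := exists_killingForm_ne_zero hx hx0
    refine ⟨y, hy, ⁅f, x⁆, by rwa [hγ, neg_neg], fun h0 ↦ hxy ?_⟩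
    have hyf : ⁅y, f⁆ = 0 := by
      have : ⁅y, f⁆ ∈ rootSpace H (-((α : H → K) + β)) := by
        rw [neg_add_rev]
        exact lie_mem_genWeightSpace_of_mem_genWeightSpace hy hf
      by_contra h0
      obtain ⟨z, hz, hz0⟩ := exists_killingForm_ne_zero this h0
      rw [neg_neg, hβα, LieSubmodule.mem_bot] at hz
      simp [hz] at hz0
    -- As `⁅y, f⁆ = 0`, the bracket `⁅y, ⁅f, x⁆⁆ = ⁅f, ⁅y, x⁆⁆` is a multiple of `f`.
    have hyx : ⁅y, x⁆ = -(killingForm K L x y •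
        ((cartanEquivDual H).symm (Weight.toLinear K H L β) : L)) := by
      rw [← lie_skew, lie_eq_killingForm_smul_of_mem_rootSpace_of_mem_rootSpace_neg hx hy]
    have hf' : ⁅((cartanEquivDual H).symm (Weight.toLinear K H L β) : L), f⁆ =
        -α ((cartanEquivDual H).symm (Weight.toLinear K H L β)) • f :=
      lie_eq_smul_of_mem_rootSpace hf _
    rw [leibniz_lie, hyf, zero_lie, zero_add, hyx, lie_neg, lie_smul, ← lie_skew, hf'] at h0
    simp only [neg_smul, neg_neg, neg_eq_zero, smul_smul, smul_eq_zero, mul_eq_zero,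
      ht.f_ne_zero, or_false] at h0
    refine h0.resolve_right fun h0 ↦ hβc ?_
    have hβt : β ((cartanEquivDual H).symm (Weight.toLinear K H L α)) = 0 := by
      have sym (ξ η : Dual K H) : ξ ((cartanEquivDual H).symm η) =
          η ((cartanEquivDual H).symm ξ) := by
        obtain ⟨a, rfl⟩ := (cartanEquivDual H).surjective ξ
        obtain ⟨b, rfl⟩ := (cartanEquivDual H).surjective η
        rw [LinearEquiv.symm_apply_apply, LinearEquiv.symm_apply_apply]
        exact LieModule.traceForm_comm K H L a b
      rw [← Weight.toLinear_apply, sym, Weight.toLinear_apply, h0]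
    rw [← Weight.toLinear_apply, coroot, map_nsmul, map_smul, Weight.toLinear_apply, hβt,
      smul_zero, smul_zero]

end LieAlgebra.IsKilling

namespace LieAlgebra.IsKilling

open LieModule Module

variable {K L : Type*} [Field K] [LieRing L] [LieAlgebra K L]

/-! ### Bilinear forms satisfying the Bianchi identity -/

/-- The form `(u ∧ v, w ∧ x) ↦ B ⁅u, v⁆ ⁅w, x⁆` satisfies the algebraic Bianchi identity. For
example, the Jacobi identity says that an invariant form `B` has this property. -/
def SatisfiesBianchi (B : BilinForm K L) : Prop :=
  ∀ u v w x : L, B ⁅u, v⁆ ⁅w, x⁆ + B ⁅v, w⁆ ⁅u, x⁆ + B ⁅w, u⁆ ⁅v, x⁆ = 0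

variable [CharZero K] [IsKilling K L] [FiniteDimensional K L]
  {H : LieSubalgebra K L} [H.IsCartanSubalgebra] [IsTriangularizable K H L]
  {B : BilinForm K L}

lemma coe_lie_of_mem_rootSpace {α : H → K} {x : L} (hx : x ∈ rootSpace H α) (h : H) :
    ⁅(h : L), x⁆ = α h • x :=
  lie_eq_smul_of_mem_rootSpace hx h

lemma lie_coe_of_mem_rootSpace {α : H → K} {x : L} (hx : x ∈ rootSpace H α) (h : H) :
    ⁅x, (h : L)⁆ = -(α h • x) := by
  rw [← lie_skew, coe_lie_of_mem_rootSpace hx]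

namespace SatisfiesBianchi

/-- Root spaces of non-proportional weights are orthogonal: take two arguments in the Cartan
subalgebra. The hypothesis `hst` says that `α` and `β` are linearly independent. -/
lemma apply_eq_zero_of_mul_ne_mul (hB : SatisfiesBianchi B) {α β : H → K} {s t : H}
    (hst : α s * β t ≠ α t * β s) {x y : L} (hx : x ∈ rootSpace H α) (hy : y ∈ rootSpace H β) :
    B x y = 0 := by
  have h := hB s t x y
  have h0 : ⁅(s : L), (t : L)⁆ = 0 := by
    rw [← LieSubalgebra.coe_bracket, trivial_lie_zero, ZeroMemClass.coe_zero]
  rw [h0, coe_lie_of_mem_rootSpace hx, lie_coe_of_mem_rootSpace hx, coe_lie_of_mem_rootSpace hy,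
    coe_lie_of_mem_rootSpace hy] at h
  simp only [map_zero, map_neg, map_smul, LinearMap.zero_apply, LinearMap.neg_apply,
    LinearMap.smul_apply, smul_eq_mul, zero_add] at h
  have h' : (α s * β t - α t * β s) * B x y = 0 := by linear_combination -h
  exact (mul_eq_zero.mp h').resolve_left (sub_ne_zero.mpr hst)

/-- The Bianchi identity with one argument in the Cartan subalgebra, in the kernel of the weight of
a second one. -/
lemma apply_lie_add_lie_apply (hB : SatisfiesBianchi B) {α β δ : H → K} {t : H} (ht : β t = 0)
    {v w x : L} (hv : v ∈ rootSpace H α) (hw : w ∈ rootSpace H β) (hx : x ∈ rootSpace H δ) :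
    α t * B v ⁅w, x⁆ + δ t * B ⁅v, w⁆ x = 0 := by
  have h := hB t v w x
  rw [coe_lie_of_mem_rootSpace hv, lie_coe_of_mem_rootSpace hw, coe_lie_of_mem_rootSpace hx,
    ht] at h
  simpa using h

/-- Root spaces are orthogonal to the Cartan subalgebra, because they are orthogonal to
`⁅L_γ, L_-γ⁆` for every root `γ` not proportional to the given one. -/
lemma apply_cartan_eq_zero [IsSimple K L] (hrank : finrank K H ≠ 1) (hB : SatisfiesBianchi B)
    {α : Weight K H L} (hα : α.IsNonZero)
    {x : L} (hx : x ∈ rootSpace H α) (s : H) : B x s = 0 := by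
  have key := dual_linearMap_eq_zero hrank hα
    ((B x).comp (H.toSubmodule.subtype ∘ₗ (cartanEquivDual H).symm.toLinearMap)) ?_
  · simpa using LinearMap.congr_fun key (cartanEquivDual H s)
  intro γ hγ hγα hγα'
  obtain ⟨t, ht, ht'⟩ := exists_apply_eq_zero_and_ne_zero (exists_mul_ne_mul hα hγ hγα hγα')
  obtain ⟨e, he, he0⟩ := γ.exists_ne_zero
  obtain ⟨f, hf, hf0⟩ := exists_killingForm_ne_zero he he0
  have h3 := hB.apply_lie_add_lie_apply ht hx he hf
  rw [Pi.neg_apply, ht, neg_zero, zero_mul, add_zero,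
    lie_eq_killingForm_smul_of_mem_rootSpace_of_mem_rootSpace_neg he hf, map_smul, smul_eq_mul] at h3
  simpa [ht', hf0] using h3

/-- Root spaces are isotropic: write `L_α = ⁅L_β, L_γ⁆` and move `L_β` to the other argument, where
`α + β` and `γ = α - β` are linearly independent. -/
lemma apply_self_rootSpace_eq_zero [IsSimple K L] (hrank : finrank K H ≠ 1)
    (hB : SatisfiesBianchi B) {α : Weight K H L} (hα : α.IsNonZero) {x y : L} (hx : x ∈ rootSpace H α) (hy : y ∈ rootSpace H α) : B x y = 0 := by
  obtain ⟨β, γ, hadd, -, -, ⟨s, t, hst⟩, ⟨u, hu, v, hv, huv⟩, -⟩ := exists_add_eq_root hrank hα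
  have huv' : ⁅u, v⁆ ∈ rootSpace H α := by
    rw [← hadd]
    exact lie_mem_genWeightSpace_of_mem_genWeightSpace hu hv
  obtain ⟨c, rfl⟩ := exists_smul_eq_of_mem_rootSpace hα huv' huv hy
  obtain ⟨r, hr, hr'⟩ := exists_apply_eq_zero_and_ne_zero ⟨s, t, hst⟩
  have hxu : B ⁅x, u⁆ v = 0 := by
    have e (q : H) : γ q = α q - β q := by rw [← hadd, Pi.add_apply]; ring
    refine hB.apply_eq_zero_of_mul_ne_mul (s := s) (t := t) (fun h' ↦ hst ?_)
      (lie_mem_genWeightSpace_of_mem_genWeightSpace hx hu) hv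
    simp only [Pi.add_apply, e] at h'
    linear_combination -(1 / 2 : K) * h'
  have h3 := hB.apply_lie_add_lie_apply hr hx hu hv
  rw [hxu, mul_zero, add_zero] at h3
  simp [(mul_eq_zero.mp h3).resolve_left hr']

/-- On root vectors whose weights `β`, `γ`, `-α` sum to zero, `B ⁅u, v⁆ w` is cyclically symmetric:
the Bianchi identity with fourth argument `r` in the Cartan subalgebra is a linear relation between
`α r` and `β r`, and `α`, `β` are linearly independent. -/
lemma apply_lie_cyclic (hB : SatisfiesBianchi B) {α β γ : Weight K H L}
    (hadd : (β : H → K) + γ = α) (hind : ∃ s t : H, α s * β t ≠ α t * β s) {u v w : L}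
    (hu : u ∈ rootSpace H β) (hv : v ∈ rootSpace H γ) (hw : w ∈ rootSpace H (-α)) :
    B ⁅v, w⁆ u = B ⁅u, v⁆ w ∧ B ⁅w, u⁆ v = B ⁅u, v⁆ w := by
  obtain ⟨s, t, hst⟩ := hind
  have key (r : H) : α r * (B ⁅w, u⁆ v - B ⁅u, v⁆ w) = β r * (B ⁅w, u⁆ v - B ⁅v, w⁆ u) := by
    have h := hB u v w r
    have e : γ r = α r - β r := by rw [← hadd, Pi.add_apply]; ring
    rw [lie_coe_of_mem_rootSpace hu, lie_coe_of_mem_rootSpace hv, lie_coe_of_mem_rootSpace hw] at h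
    simp only [Pi.neg_apply, map_neg, map_smul, smul_eq_mul, e] at h
    linear_combination -h
  have k1 : (α s * β t - α t * β s) * (B ⁅w, u⁆ v - B ⁅u, v⁆ w) = 0 := by
    linear_combination β t * key s - β s * key t
  have k2 : (α s * β t - α t * β s) * (B ⁅w, u⁆ v - B ⁅v, w⁆ u) = 0 := by
    linear_combination α t * key s - α s * key t
  have k1' := (mul_eq_zero.mp k1).resolve_left (sub_ne_zero.mpr hst)
  have k2' := (mul_eq_zero.mp k2).resolve_left (sub_ne_zero.mpr hst)
  exact ⟨by linear_combination k1' - k2', by linear_combination k1'⟩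

end SatisfiesBianchi

/-! ### The symmetric part of a weak curvature endomorphism -/

/-- Twice the symmetric part of an endomorphism `P` with respect to the Killing form, as the
bilinear form `(x, y) ↦ (P x, y) + (x, P y)`. It vanishes if and only if `P` is skew-symmetric. -/
noncomputable def killingSymmPart (P : L →ₗ[K] L) : BilinForm K L :=
  (killingForm K L).compl₁₂ P .id + (killingForm K L).compl₁₂ .id P

omit [CharZero K] [IsKilling K L] [FiniteDimensional K L] in
lemma killingSymmPart_apply (P : L →ₗ[K] L) (x y : L) :
    killingSymmPart P x y = killingForm K L (P x) y + killingForm K L x (P y) := rfl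

omit [CharZero K] [IsKilling K L] [FiniteDimensional K L] in
lemma killingForm_lie_right (x y z : L) : killingForm K L ⁅x, y⁆ z = killingForm K L ⁅y, z⁆ x := by
  rw [LieModule.traceForm_apply_lie_apply, LieModule.traceForm_comm]

omit [CharZero K] [IsKilling K L] [FiniteDimensional K L] in
lemma killingSymmPart_comm (P : L →ₗ[K] L) (x y : L) :
    killingSymmPart P x y = killingSymmPart P y x := by
  simp only [killingSymmPart_apply]
  rw [LieModule.traceForm_comm K L L (P x), LieModule.traceForm_comm K L L x, add_comm]

lemma lie_lie_add_cyclic_eq_zero {L : Type*} [LieRing L] (u v w : L) :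
    ⁅⁅u, v⁆, w⁆ + ⁅⁅v, w⁆, u⁆ + ⁅⁅w, u⁆, v⁆ = 0 := by
  rw [← lie_skew ⁅u, v⁆ w, ← lie_skew ⁅v, w⁆ u, ← lie_skew ⁅w, u⁆ v, ← neg_add, ← neg_add,
    add_assoc, add_comm, lie_jacobi, neg_zero]

omit [CharZero K] [IsKilling K L] [FiniteDimensional K L] in
/-- The cyclic identity expresses each term `killingForm (P ⁅u, v⁆) ⁅w, x⁆` through `P u`, `P v`,
`P w` and `P x`; in the sum these cancel by the Jacobi identity. -/
lemma satisfiesBianchi_killingSymmPart {P : L →ₗ[K] L}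
    (hP : ∀ u v w : L, killingForm K L (P u) ⁅v, w⁆ +
      killingForm K L (P v) ⁅w, u⁆ + killingForm K L (P w) ⁅u, v⁆ = 0) :
    SatisfiesBianchi (killingSymmPart P) := by
  intro u v w x
  -- The coefficients of `P u`, `P v`, `P w` and `P x` vanish by the Jacobi identity.
  have jac (a b c : L) : ⁅a, ⁅b, c⁆⁆ + ⁅b, ⁅c, a⁆⁆ + ⁅⁅b, a⁆, c⁆ = 0 := by
    rw [← lie_skew ⁅b, a⁆ c, ← lie_skew b a, lie_neg, neg_neg, lie_jacobi]
  have ju := congrArg (killingForm K L (P u)) (jac x v w)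
  have jv := congrArg (killingForm K L (P v)) (jac x w u)
  have jw := congrArg (killingForm K L (P w)) (jac x u v)
  have jx := congrArg (killingForm K L (P x)) (lie_lie_add_cyclic_eq_zero u v w)
  have swap (a b c d : L) : killingForm K L ⁅a, b⁆ (P ⁅c, d⁆) =
      killingForm K L (P ⁅c, d⁆) ⁅a, b⁆ := LieModule.traceForm_comm K L L _ _
  simp only [map_add, map_zero] at ju jv jw jx
  simp only [killingSymmPart_apply, swap]
  linear_combination hP ⁅u, v⁆ w x + hP ⁅w, x⁆ u v + hP ⁅v, w⁆ u x + hP ⁅u, x⁆ v w +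
    hP ⁅w, u⁆ v x + hP ⁅v, x⁆ w u - ju - jv - jw - jx

omit [CharZero K] in
/-- Three root vectors whose weights sum to zero pair cyclically with each other's brackets. -/
lemma exists_killingForm_cyclic {α β γ : H → K} (hadd : β + γ = α) {u v : L}
    (hu : u ∈ rootSpace H β) (hv : v ∈ rootSpace H γ) (huv : ⁅u, v⁆ ≠ 0) :
    ∃ w ∈ rootSpace H (-α), ∃ k : K, k ≠ 0 ∧
      ⁅u, v⁆ ∈ rootSpace H α ∧ ⁅v, w⁆ ∈ rootSpace H (-β) ∧ ⁅w, u⁆ ∈ rootSpace H (-γ) ∧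
      killingForm K L u ⁅v, w⁆ = k ∧ killingForm K L v ⁅w, u⁆ = k ∧
      killingForm K L w ⁅u, v⁆ = k := by
  have huvα : ⁅u, v⁆ ∈ rootSpace H α := by
    rw [← hadd]; exact lie_mem_genWeightSpace_of_mem_genWeightSpace hu hv
  obtain ⟨w, hw, hk⟩ := exists_killingForm_ne_zero huvα huv
  refine ⟨w, hw, _, hk, huvα, ?_, ?_, ?_, ?_, ?_⟩
  · rw [show -β = γ + -α by rw [← hadd]; abel]
    exact lie_mem_genWeightSpace_of_mem_genWeightSpace hv hw
  · rw [show -γ = -α + β by rw [← hadd]; abel]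
    exact lie_mem_genWeightSpace_of_mem_genWeightSpace hw hu
  · rw [LieModule.traceForm_comm, ← killingForm_lie_right]
  · rw [LieModule.traceForm_comm, killingForm_lie_right]
  · rw [LieModule.traceForm_comm]

omit [CharZero K] in
/-- If `P` acts on the root spaces of `β`, `γ` and `-(β + γ)` with diagonal coefficients `p`, and the
first two root spaces have non-zero bracket, then the three coefficients sum to zero. -/
lemma diagonal_coeff_sum_eq_zero {P : L →ₗ[K] L}
    (hP : ∀ u v w : L, killingForm K L (P u) ⁅v, w⁆ +
      killingForm K L (P v) ⁅w, u⁆ + killingForm K L (P w) ⁅u, v⁆ = 0)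
    {p : Weight K H L → K}
    (hp : ∀ α : Weight K H L, α.IsNonZero → ∀ x ∈ rootSpace H α, ∀ y ∈ rootSpace H (-α),
      killingForm K L (P x) y = p α * killingForm K L x y)
    {α β γ : Weight K H L} (hα : α.IsNonZero) (hβ : β.IsNonZero) (hγ : γ.IsNonZero)
    (hadd : (β : H → K) + γ = α)
    {u v : L} (hu : u ∈ rootSpace H β) (hv : v ∈ rootSpace H γ) (huv : ⁅u, v⁆ ≠ 0) :
    p β + p γ + p (-α) = 0 := by
  obtain ⟨w, hw, k, hk, huvα, hvw, hwu, k1, k2, k3⟩ := exists_killingForm_cyclic hadd hu hv huv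
  have h := hP u v w
  rw [hp β hβ u hu _ hvw, hp γ hγ v hv _ hwu, hp (-α) (by simpa) w hw _ (by simpa using huvα),
    k1, k2, k3] at h
  exact (mul_eq_zero.mp (by linear_combination h)).resolve_right hk

/-- Let `s α = p α + p (-α)`, where `p` gives the diagonal coefficients of `P` on the root spaces.
For a decomposition `α = β + γ` the Bianchi identity gives `s α = s β = s γ`, whereas the cyclic
identity for `P`, applied to `β`, `γ`, `-α` and to the opposite roots, gives
`s α + s β + s γ = 0`. -/
lemma killingSymmPart_apply_neg_eq_zero [IsSimple K L] (hrank : finrank K H ≠ 1) {P : L →ₗ[K] L}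
    (hP : ∀ u v w : L, killingForm K L (P u) ⁅v, w⁆ +
      killingForm K L (P v) ⁅w, u⁆ + killingForm K L (P w) ⁅u, v⁆ = 0)
    {α : Weight K H L} (hα : α.IsNonZero) {x y : L} (hx : x ∈ rootSpace H α)
    (hy : y ∈ rootSpace H (-α)) : killingSymmPart P x y = 0 := by
  have hex (ξ : Weight K H L) : ∃ c, ξ.IsNonZero → ∀ x ∈ rootSpace H ξ, ∀ y ∈ rootSpace H (-ξ),
      killingForm K L (P x) y = c * killingForm K L x y := by
    by_cases hξ : ξ.IsNonZero
    · obtain ⟨c, hc⟩ := exists_apply_eq_mul_killingForm ((killingForm K L).compl₁₂ P .id) hξ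
      exact ⟨c, fun _ ↦ hc⟩
    · exact ⟨0, fun h ↦ absurd h hξ⟩
  choose p hp using hex
  have hS {ξ : Weight K H L} (hξ : ξ.IsNonZero) {x y : L} (hx : x ∈ rootSpace H ξ)
      (hy : y ∈ rootSpace H (-ξ)) :
      killingSymmPart P x y = (p ξ + p (-ξ)) * killingForm K L x y := by
    rw [killingSymmPart_apply, hp ξ hξ x hx y hy, LieModule.traceForm_comm K L L x (P y),
      hp (-ξ) (by simpa) y hy x (by simpa using hx), LieModule.traceForm_comm K L L y x]
    ring
  obtain ⟨β, γ, hadd, hβ, hγ, hind, ⟨u, hu, v, hv, huv⟩, ⟨u', hu', v', hv', huv'⟩⟩ :=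
    exists_add_eq_root hrank hα
  have hsum := diagonal_coeff_sum_eq_zero hP hp hα hβ hγ hadd hu hv huv
  have hsum' := diagonal_coeff_sum_eq_zero hP hp (α := -α) (β := -β) (γ := -γ)
    (by simpa) (by simpa) (by simpa)
    (by simp only [Weight.coe_neg, ← hadd, neg_add]) hu' hv' huv'
  rw [neg_neg] at hsum'
  obtain ⟨w, hw, k, hk, huvα, hvw, hwu, k1, k2, k3⟩ := exists_killingForm_cyclic hadd hu hv huv
  obtain ⟨c1, c2⟩ := (satisfiesBianchi_killingSymmPart hP).apply_lie_cyclic hadd hind hu hv hw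
  rw [killingSymmPart_comm, hS hβ hu hvw, hS hα huvα hw, LieModule.traceForm_comm K L L ⁅u, v⁆,
    k1, k3] at c1
  rw [killingSymmPart_comm, hS hγ hv hwu, hS hα huvα hw, LieModule.traceForm_comm K L L ⁅u, v⁆,
    k2, k3] at c2
  have hβα := mul_right_cancel₀ hk c1
  have hγα := mul_right_cancel₀ hk c2
  have h0 : p α + p (-α) = 0 := by
    linear_combination (hsum + hsum' - hβα - hγα) / 3
  rw [hS hα hx hy, h0, zero_mul]

/-- The Bianchi identity on `L_α`, `L_-α`, `L_β`, `L_-β` reduces the values on the Cartan subalgebra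
to values on pairs of opposite root spaces. -/
lemma killingSymmPart_apply_cartan_eq_zero [IsSimple K L] (hrank : finrank K H ≠ 1)
    {P : L →ₗ[K] L} (hP : ∀ u v w : L, killingForm K L (P u) ⁅v, w⁆ +
      killingForm K L (P v) ⁅w, u⁆ + killingForm K L (P w) ⁅u, v⁆ = 0) (s t : H) :
    killingSymmPart P s t = 0 := by
  have hneg {ξ : H → K} {x y : L} (hξ : ξ ≠ 0) (hx : x ∈ rootSpace H ξ)
      (hy : y ∈ rootSpace H (-ξ)) : killingSymmPart P x y = 0 := by
    by_cases h0 : rootSpace H ξ = ⊥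
    · rw [(LieSubmodule.mem_bot x).mp (h0.le hx)]
      simp
    · exact killingSymmPart_apply_neg_eq_zero hrank hP (α := ⟨ξ, h0⟩) hξ hx hy
  have hroots (α β : Weight K H L) (hα : α.IsNonZero) (hβ : β.IsNonZero) (h₁ : β ≠ α)
      (h₂ : β ≠ -α) : killingSymmPart P
        ((cartanEquivDual H).symm (Weight.toLinear K H L α) : L)
        ((cartanEquivDual H).symm (Weight.toLinear K H L β) : L) = 0 := by
    obtain ⟨a, ha, ha0⟩ := α.exists_ne_zero
    obtain ⟨a', ha', haa⟩ := exists_killingForm_ne_zero ha ha0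
    obtain ⟨b, hb, hb0⟩ := β.exists_ne_zero
    obtain ⟨b', hb', hbb⟩ := exists_killingForm_ne_zero hb hb0
    have h := satisfiesBianchi_killingSymmPart hP a a' b b'
    have hba : killingSymmPart P ⁅a', b⁆ ⁅a, b'⁆ = 0 := by
      refine hneg (ξ := -α + β) (fun h0 ↦ h₁ ?_)
        (lie_mem_genWeightSpace_of_mem_genWeightSpace ha' hb) ?_
      · exact DFunLike.coe_injective (neg_add_eq_zero.mp h0).symm
      · rw [neg_add, neg_neg]
        exact lie_mem_genWeightSpace_of_mem_genWeightSpace ha hb'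
    have hab : killingSymmPart P ⁅b, a⁆ ⁅a', b'⁆ = 0 := by
      refine hneg (ξ := β + α) (fun h0 ↦ h₂ ?_)
        (lie_mem_genWeightSpace_of_mem_genWeightSpace hb ha) ?_
      · exact DFunLike.coe_injective (eq_neg_of_add_eq_zero_left h0)
      · rw [neg_add_rev]
        exact lie_mem_genWeightSpace_of_mem_genWeightSpace ha' hb'
    rw [hba, hab, lie_eq_killingForm_smul_of_mem_rootSpace_of_mem_rootSpace_neg ha ha',
      lie_eq_killingForm_smul_of_mem_rootSpace_of_mem_rootSpace_neg hb hb'] at h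
    simpa [haa, hbb] using h
  have hleft (α : Weight K H L) (hα : α.IsNonZero) (t : H) : killingSymmPart P
      ((cartanEquivDual H).symm (Weight.toLinear K H L α) : L) t = 0 := by
    have key := dual_linearMap_eq_zero hrank hα
      ((killingSymmPart P ((cartanEquivDual H).symm (Weight.toLinear K H L α) : L)).comp
        (H.toSubmodule.subtype ∘ₗ (cartanEquivDual H).symm.toLinearMap))
      (fun β hβ h₁ h₂ ↦ hroots α β hα hβ h₁ h₂)
    simpa using LinearMap.congr_fun key (cartanEquivDual H t)
  have key : ((killingSymmPart P).flip t).comp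
      (H.toSubmodule.subtype ∘ₗ (cartanEquivDual H).symm.toLinearMap) = 0 := by
    refine LinearMap.ext_on (span_weight_isNonZero_eq_top K L H) ?_
    rintro _ ⟨α, hα, rfl⟩
    exact hleft α hα t
  simpa using LinearMap.congr_fun key (cartanEquivDual H s)

/-- In rank at least two, a solution `P` of the cyclic identity is skew-symmetric with respect to the
Killing form. -/
theorem killingSymmPart_eq_zero [IsSimple K L] (hrank : finrank K H ≠ 1)
    {P : L →ₗ[K] L} (hP : ∀ u v w : L, killingForm K L (P u) ⁅v, w⁆ +
      killingForm K L (P v) ⁅w, u⁆ + killingForm K L (P w) ⁅u, v⁆ = 0) :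
    killingSymmPart P = 0 := by
  have hB := satisfiesBianchi_killingSymmPart hP
  have hz {x : L} {α : Weight K H L} (hα : α.IsZero) (hx : x ∈ rootSpace H α) :
      ∃ s : H, s = x := by
    rw [hα.eq] at hx
    have : x ∈ H := by simpa [rootSpace_zero_eq] using hx
    exact ⟨⟨x, this⟩, rfl⟩
  refine bilinForm_eq_zero_of_weightSpaces (H := H) _ fun α β x hx y hy ↦ ?_
  by_cases hα : α.IsZero
  · obtain ⟨s, rfl⟩ := hz hα hx
    by_cases hβ : β.IsZero
    · obtain ⟨t, rfl⟩ := hz hβ hy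
      exact killingSymmPart_apply_cartan_eq_zero hrank hP s t
    · rw [killingSymmPart_comm]
      exact hB.apply_cartan_eq_zero hrank hβ hy s
  by_cases hβ : β.IsZero
  · obtain ⟨t, rfl⟩ := hz hβ hy
    exact hB.apply_cartan_eq_zero hrank hα hx t
  by_cases h₁ : β = α
  · exact hB.apply_self_rootSpace_eq_zero hrank hα hx (h₁ ▸ hy)
  by_cases h₂ : β = -α
  · rw [h₂] at hy
    exact killingSymmPart_apply_neg_eq_zero hrank hP hα hx hy
  obtain ⟨s, t, hst⟩ := exists_mul_ne_mul hα hβ h₁ h₂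
  exact hB.apply_eq_zero_of_mul_ne_mul hst hx hy

/-- In rank at least two, every solution of the cyclic identity is an inner derivation. -/
theorem exists_eq_lie_of_cyclic_sum [IsSimple K L] (hrank : finrank K H ≠ 1)
    {P : L →ₗ[K] L} (hP : ∀ u v w : L, killingForm K L (P u) ⁅v, w⁆ +
      killingForm K L (P v) ⁅w, u⁆ + killingForm K L (P w) ⁅u, v⁆ = 0) :
    ∃ x : L, ∀ y, P y = ⁅y, x⁆ := by
  have hskew (x y : L) : killingForm K L (P x) y + killingForm K L x (P y) = 0 :=
    LinearMap.congr_fun₂ (killingSymmPart_eq_zero hrank hP) x y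
  have hder (u v : L) : P ⁅u, v⁆ = ⁅u, P v⁆ - ⁅v, P u⁆ := by
    rw [← sub_eq_zero, ← LinearMap.ker_eq_bot'.mp (ker_killingForm_eq_bot K L) _]
    ext w
    have h := hP u v w
    have h1 := hskew ⁅u, v⁆ w
    have h2 : killingForm K L ⁅v, P u⁆ w = -killingForm K L (P u) ⁅v, w⁆ :=
      LieModule.traceForm_apply_lie_apply' K L L v (P u) w
    have h3 : killingForm K L ⁅u, P v⁆ w = killingForm K L (P v) ⁅w, u⁆ := by
      rw [killingForm_lie_right, killingForm_lie_right, LieModule.traceForm_comm]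
    rw [LieModule.traceForm_comm K L L _ (P w)] at h1
    simp only [map_sub, LinearMap.sub_apply, LinearMap.zero_apply, h2, h3]
    linear_combination h1 - h
  obtain ⟨x, hx⟩ := LieDerivation.IsKilling.exists_eq_ad (R := K) (L := L) ⟨P, hder⟩
  refine ⟨-x, fun y ↦ ?_⟩
  have h : P y = ⁅x, y⁆ := by simpa using (LieDerivation.congr_fun hx y).symm
  rw [lie_neg, lie_skew, h]

end LieAlgebra.IsKilling

open LieModule LieAlgebra

/-! ### The adjoint representation -/

section Adjoint

lemma OrthogonalRep.map_contract {K 𝔥 V W W' : Type*} [Field K] [LieRing 𝔥] [LieAlgebra K 𝔥]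
    [AddCommGroup V] [Module K V] [LieRingModule 𝔥 V] [LieModule K 𝔥 V] [AddCommGroup W]
    [Module K W] [AddCommGroup W'] [Module K W'] [FiniteDimensional K V]
    (ρ : OrthogonalRep K 𝔥 V) (β : V →ₗ[K] V →ₗ[K] W) (f : W →ₗ[K] W') :
    f (ρ.contract β) = ρ.contract (β.compr₂ f) := by
  simp only [contract, map_sum, LinearMap.compr₂_apply]

variable {K 𝔥 : Type*} [Field K] [LieRing 𝔥] [LieAlgebra K 𝔥] [FiniteDimensional K 𝔥]
  [LieAlgebra.IsKilling K 𝔥]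

/-- In terms of the Killing form, `𝓟(𝔥)` is given by a cyclic identity without the action. -/
lemma mem_curvP_adjointRep_iff (P : 𝔥 →ₗ[K] 𝔥) :
    P ∈ (adjointRep K 𝔥).curvP ↔ ∀ u v w : 𝔥, killingForm K 𝔥 (P u) ⁅v, w⁆ +
      killingForm K 𝔥 (P v) ⁅w, u⁆ + killingForm K 𝔥 (P w) ⁅u, v⁆ = 0 := by
  simp only [OrthogonalRep.mem_curvP, adjointRep, LieModule.traceForm_apply_lie_apply]

lemma mem_curvP_adjointRep_of_forall_eq_lie {P : 𝔥 →ₗ[K] 𝔥} {x : 𝔥} (hP : ∀ y, P y = ⁅y, x⁆) :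
    P ∈ (adjointRep K 𝔥).curvP := by
  rw [mem_curvP_adjointRep_iff]
  intro u v w
  have e (a b : 𝔥) : killingForm K 𝔥 ⁅a, x⁆ b = killingForm K 𝔥 x ⁅b, a⁆ := by
    rw [LieModule.traceForm_comm, ← LieModule.traceForm_apply_lie_apply, LieModule.traceForm_comm]
  rw [hP, hP, hP, e, e, e, ← map_add, ← map_add]
  rw [IsKilling.lie_lie_add_cyclic_eq_zero, map_zero]

/-- The Casimir element of the Killing form acts as the identity on the adjoint representation. -/
lemma ricTilde_adjointRep_of_forall_eq_lie {P : 𝔥 →ₗ[K] 𝔥} {x : 𝔥} (hP : ∀ y, P y = ⁅y, x⁆) :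
    (adjointRep K 𝔥).ricTilde P = -x := by
  rw [← sub_eq_zero, ← LinearMap.ker_eq_bot'.mp (IsKilling.ker_killingForm_eq_bot K 𝔥) _]
  ext z
  have e : ((toEnd K 𝔥 𝔥 : 𝔥 →ₗ[K] Module.End K 𝔥) ∘ₗ P).compr₂ ((killingForm K 𝔥).flip z) =
      (killingForm K 𝔥).compl₁₂ (toEnd K 𝔥 𝔥 x) (toEnd K 𝔥 𝔥 z) := by
    ext a b
    change killingForm K 𝔥 ⁅P a, b⁆ z = killingForm K 𝔥 ⁅x, a⁆ ⁅z, b⁆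
    rw [LieModule.traceForm_apply_lie_apply, hP, ← lie_skew a x, ← lie_skew b z, map_neg, map_neg,
      LinearMap.neg_apply, neg_neg]
  have h : killingForm K 𝔥 ((adjointRep K 𝔥).ricTilde P) z = -killingForm K 𝔥 x z := by
    refine ((adjointRep K 𝔥).map_contract _ ((killingForm K 𝔥).flip z)).trans ?_
    rw [e]
    exact ((adjointRep K 𝔥).trace_eq_contract x z).symm
  rw [map_sub, LinearMap.sub_apply, h, map_neg, LinearMap.neg_apply, sub_self,
    LinearMap.zero_apply]

end Adjoint

theorem mainTheorem5 (𝔥 : Type*) [LieRing 𝔥] [LieAlgebra ℂ 𝔥] [FiniteDimensional ℂ 𝔥]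
    [LieAlgebra.IsSimple ℂ 𝔥]
    (hsl : IsEmpty (𝔥 ≃ₗ⁅ℂ⁆ LieAlgebra.SpecialLinear.sl (Fin 2) ℂ)) :
    (adjointRep ℂ 𝔥).curvP = (adjointRep ℂ 𝔥).curvP₁ ∧
    Nonempty ((adjointRep ℂ 𝔥).curvP₁ ≃ₗ⁅ℂ,𝔥⁆ 𝔥) ∧
    ∀ P ∈ (adjointRep ℂ 𝔥).curvP, ∃ x : 𝔥, ∀ y : 𝔥, P y = ⁅y, x⁆ := by
  have hinner : ∀ P ∈ (adjointRep ℂ 𝔥).curvP, ∃ x : 𝔥, ∀ y : 𝔥, P y = ⁅y, x⁆ := by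
    obtain ⟨x, hx⟩ := exists_isCartanSubalgebra_engel (K := ℂ) (L := 𝔥)
    have hrank : Module.finrank ℂ (LieSubalgebra.engel ℂ x) ≠ 1 := fun h ↦
      (IsKilling.nonempty_equiv_sl_two_of_finrank_eq_one h).elim hsl.elim
    exact fun P hP ↦ IsKilling.exists_eq_lie_of_cyclic_sum hrank ((mem_curvP_adjointRep_iff P).mp hP)
  have hP₀ : ∀ P ∈ (adjointRep ℂ 𝔥).curvP, (adjointRep ℂ 𝔥).ricTilde P = 0 → P = 0 := by
    intro P hP hric
    obtain ⟨x, hx⟩ := hinner P hP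
    rw [ricTilde_adjointRep_of_forall_eq_lie hx, neg_eq_zero] at hric
    ext y
    rw [hx, hric, lie_zero, LinearMap.zero_apply]
  have heq : (adjointRep ℂ 𝔥).curvP = (adjointRep ℂ 𝔥).curvP₁ := by
    refine le_antisymm (fun Q hQ ↦ ⟨hQ, fun P hP ↦ ?_⟩) fun Q hQ ↦ hQ.1
    rw [hP₀ P hP.1 (by simpa using hP.2)]
    simp [OrthogonalRep.homInner, OrthogonalRep.contract]
  let φ : (adjointRep ℂ 𝔥).curvP₁ →ₗ⁅ℂ,𝔥⁆ 𝔥 :=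
    (adjointRep ℂ 𝔥).ricTilde.comp (adjointRep ℂ 𝔥).curvP₁.incl
  have hφ : Function.Bijective φ := by
    constructor
    · rw [injective_iff_map_eq_zero]
      exact fun P hP ↦ Subtype.ext (hP₀ P.1 P.2.1 hP)
    · intro x
      have hx (y : 𝔥) : toEnd ℂ 𝔥 𝔥 x y = ⁅y, -x⁆ := by
        rw [lie_neg, lie_skew, toEnd_apply_apply]
      refine ⟨⟨toEnd ℂ 𝔥 𝔥 x, heq ▸ mem_curvP_adjointRep_of_forall_eq_lie hx⟩, ?_⟩
      exact (ricTilde_adjointRep_of_forall_eq_lie hx).trans (neg_neg x)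
  exact ⟨heq, ⟨{ LinearEquiv.ofBijective (φ : (adjointRep ℂ 𝔥).curvP₁ →ₗ[ℂ] 𝔥) hφ with
    map_lie' := φ.map_lie' }⟩, hinner⟩
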